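/- Let $(M,g)$ be a spacetime of class $C^r$, $r\in\{3,4,\dots,\infty\}$, of dimension $n\ge 2$: $M$ is a connected (Hausdorff, second countable) $C^r$ manifold of dimension $n$, $g$ is a Lorentzian metric on $M$ of signature $(-,+,\dots,+)$ and class $C^{r-1}$ (with $\infty-1=\infty$), and $(M,g)$ is time oriented by a continuous timelike vector field. Causal curves are future-directed and piecewise $C^1$. Let $J^+\subset M\times M$ be the causal relation, that is, the set of pairs $(x,y)$ such that $x=y$ or there is a causal curve from $x$ to $y$. Let $A^+=\overline{J^+}$ be its closure in $M\times M$, and let $K^+$ be the smallest closed and transitive relation on $M$ that contains $J^+$. The spacetime is called *causally easy* if $A^+$ is antisymmetric and $A^+=K^+$. It is called *strongly causal* if for every $x\in M$ every neighbourhood $U$ of $x$ contains a neighbourhood $V$ of $x$ such that every causal curve with both endpoints in $V$ is entirely contained in $U$. **Proposition.** $(M,g)$ is causally easy if and only if it is strongly causal and the relation $\overline{J^+}$ is transitive. -/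

import Mathlib

open Set Topology Manifold ContDiff

/-- A spacetime structure of class `C^r` and dimension `n` on the manifold `M` (which is to be
connected, Hausdorff and second countable): a Lorentzian metric of signature `(-,+,…,+)` together
with a time orientation, the latter given by a continuous timelike vector field. On a manifold of
class `C^r` the tangent bundle, and hence a metric, is of class `C^(r-1)` (with `∞ - 1 = ∞`).
The instance `IsManifold (𝓡 n) 1 M` follows from the field `isManifold` for `1 ≤ r`; it is a binder
because the tangent bundle needs it. -/
structure Spacetime (n : ℕ) (r : ℕ∞) (M : Type*) [TopologicalSpace M]
    [ChartedSpace (EuclideanSpace ℝ (Fin n)) M] [IsManifold (𝓡 n) 1 M] where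
  /-- The manifold is of class `C^r`. -/
  isManifold : IsManifold (𝓡 n) (r : WithTop ℕ∞) M
  /-- The metric tensor. -/
  g : ∀ x : M, TangentSpace (𝓡 n) x →L[ℝ] TangentSpace (𝓡 n) x →L[ℝ] ℝ
  symm : ∀ (x : M) (v w : TangentSpace (𝓡 n) x), g x v w = g x w v
  /-- Signature `(-,+,…,+)`: every tangent space has an orthonormal basis whose first vector is
  timelike and whose other vectors are spacelike. -/
  signature : ∀ x : M, ∃ e : Module.Basis (Fin n) ℝ (TangentSpace (𝓡 n) x),
    ∀ i j : Fin n, g x (e i) (e j) = if i = j then (if (i : ℕ) = 0 then -1 else 1) else 0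
  /-- The metric is of class `C^(r-1)`. -/
  contMDiff : ContMDiff (𝓡 n)
    ((𝓡 n).prod 𝓘(ℝ, EuclideanSpace ℝ (Fin n) →L[ℝ] EuclideanSpace ℝ (Fin n) →L[ℝ] ℝ))
    ((r - 1 : ℕ∞) : WithTop ℕ∞)
    (fun x : M ↦ Bundle.TotalSpace.mk'
      (EuclideanSpace ℝ (Fin n) →L[ℝ] EuclideanSpace ℝ (Fin n) →L[ℝ] ℝ) x (g x))
  /-- The time orientation: a continuous timelike vector field, declared future directed. -/
  timeField : ∀ x : M, TangentSpace (𝓡 n) x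
  continuous_timeField :
    Continuous (fun x : M ↦ (⟨x, timeField x⟩ : TangentBundle (𝓡 n) M))
  timelike_timeField : ∀ x : M, g x (timeField x) (timeField x) < 0

namespace Spacetime

/-- The relation `R ⊆ M × M` is transitive. -/
def TransitiveRel {M : Type*} (R : Set (M × M)) : Prop :=
  ∀ x y z : M, (x, y) ∈ R → (y, z) ∈ R → (x, z) ∈ R

/-- The relation `R ⊆ M × M` is antisymmetric. -/
def AntisymmetricRel {M : Type*} (R : Set (M × M)) : Prop :=
  ∀ x y : M, (x, y) ∈ R → (y, x) ∈ R → x = y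

variable {n : ℕ} {r : ℕ∞} {M : Type*} [TopologicalSpace M]
  [ChartedSpace (EuclideanSpace ℝ (Fin n)) M] [IsManifold (𝓡 n) 1 M]

/-- `v` is a future-directed causal vector: it is timelike or lightlike, and lies in the same
cone as the time orientation. The strict inequality forces `v ≠ 0`. -/
def IsFutureCausal (S : Spacetime n r M) {x : M} (v : TangentSpace (𝓡 n) x) : Prop :=
  S.g x v v ≤ 0 ∧ S.g x (S.timeField x) v < 0

/-- `γ` restricted to `[a, b]`, `a < b`, is a future-directed causal curve of class `C^1`
(at `a` and `b` the velocity is the one-sided derivative). -/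
def IsCausalSegment (S : Spacetime n r M) (γ : ℝ → M) (a b : ℝ) : Prop :=
  a < b ∧ ContMDiffOn 𝓘(ℝ, ℝ) (𝓡 n) 1 γ (Icc a b) ∧
    ∀ t ∈ Icc a b, S.IsFutureCausal
      (show TangentSpace (𝓡 n) (γ t) from
        mfderivWithin 𝓘(ℝ, ℝ) (𝓡 n) γ (Icc a b) t (1 : ℝ))

/-- `γ` restricted to `[a, b]` is a (future-directed, piecewise `C^1`) causal curve. -/
def IsCausalCurve (S : Spacetime n r M) (γ : ℝ → M) (a b : ℝ) : Prop :=
  ∃ (k : ℕ) (t : ℕ → ℝ), 0 < k ∧ t 0 = a ∧ t k = b ∧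
    ∀ i < k, S.IsCausalSegment γ (t i) (t (i + 1))

/-- The causal relation `J⁺`: the pairs `(x, y)` such that `x = y` or there is a causal curve
from `x` to `y`. -/
def JPlus (S : Spacetime n r M) : Set (M × M) :=
  {p | p.1 = p.2 ∨ ∃ (γ : ℝ → M) (a b : ℝ), S.IsCausalCurve γ a b ∧ γ a = p.1 ∧ γ b = p.2}

/-- The relation `A⁺`, the closure of `J⁺` in `M × M`. -/
def APlus (S : Spacetime n r M) : Set (M × M) :=
  closure S.JPlus

/-- The relation `K⁺`, the smallest closed and transitive relation that contains `J⁺`. -/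
def KPlus (S : Spacetime n r M) : Set (M × M) :=
  ⋂₀ {R : Set (M × M) | IsClosed R ∧ TransitiveRel R ∧ S.JPlus ⊆ R}

/-- A spacetime is `A`-causal if `A⁺` is antisymmetric. -/
def ACausal (S : Spacetime n r M) : Prop :=
  AntisymmetricRel S.APlus

/-- A spacetime is causally easy if it is `A`-causal and `A⁺ = K⁺`. -/
def CausallyEasy (S : Spacetime n r M) : Prop :=
  S.ACausal ∧ S.APlus = S.KPlus

/-- A spacetime is strongly causal if every neighbourhood `U` of every point contains a
neighbourhood `V` of that point such that every causal curve with endpoints in `V` is entirely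
contained in `U`. -/
def StronglyCausal (S : Spacetime n r M) : Prop :=
  ∀ (x : M), ∀ U ∈ 𝓝 x, ∃ V ∈ 𝓝 x, V ⊆ U ∧
    ∀ (γ : ℝ → M) (a b : ℝ), S.IsCausalCurve γ a b → γ a ∈ V → γ b ∈ V →
      ∀ t ∈ Icc a b, γ t ∈ U

end Spacetime

/-! Since `K⁺` is transitive, `A⁺ = K⁺` makes `A⁺` transitive; conversely a transitive `A⁺` is
closed and contains `J⁺`, so it equals `K⁺`. What remains is to compare antisymmetry of `A⁺` with
strong causality.

If strong causality fails at `x`, causal curves with endpoints tending to `x` keep meeting the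
frontier of a compact neighbourhood of `x`. A limit `z` of the meeting points satisfies `(x, z), (z,
x) ∈ A⁺` and `z ≠ x`, against antisymmetry (`ACausal.stronglyCausal`).

Conversely let `(x, y), (y, x) ∈ A⁺` with `x ≠ y` (`StronglyCausal.aCausal`). Curves from near `x`
to near `y` cross the frontier of a small compact neighbourhood of `x` at points accumulating at
some `z`, so `(z, y) ∈ A⁺`, and transitivity gives `(z, x) ∈ A⁺`. Hence some `z'` near `z` causally
precedes some `x'` near `x`. The initial arcs end near `z`, but not at `z'`. The key lemma
`exists_nhds_subset_future` pushes such an arc slightly to the past, which makes room to reach `z'`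
from some `p` near `x`. Then `p ≤ z' ≤ x'` contradicts strong causality.

The push is explicit in a chart. Translation by `-η T` spoils causality by an error of order `η`,
because the metric is locally Lipschitz. Letting `η` decay exponentially along the curve adds a
positive multiple of `T` to the velocity and absorbs the error. -/

/-! ### Causal cones of a variable Lorentzian form on a vector space. -/

section UniformCone

variable {E : Type*} [NormedAddCommGroup E] [NormedSpace ℝ E]

/-- A bilinear form that is positive on the kernel of `τ`, minus the origin, is uniformly so:
vectors on which it is small are uniformly transverse to the kernel of `τ`. -/
theorem exists_pos_mul_norm_le_abs [FiniteDimensional ℝ E] (B : E →L[ℝ] E →L[ℝ] ℝ) (τ : E →L[ℝ] ℝ)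
    (h : ∀ v, B v v ≤ 0 → τ v = 0 → v = 0) :
    ∃ m : ℝ, 0 < m ∧ ∀ v, B v v < m * ‖v‖ ^ 2 → m * ‖v‖ ≤ |τ v| := by
  have hc : ContinuousOn (fun v : E ↦ max (B v v) |τ v|) (Metric.sphere 0 1) := by
    apply Continuous.continuousOn
    fun_prop
  obtain ⟨m, hm, hle⟩ := (isCompact_sphere (0 : E) 1).exists_forall_le' hc (a := 0) (by
    intro v hv
    by_contra! hle
    have h1 : B v v ≤ 0 := (le_max_left _ _).trans hle
    have h2 : τ v = 0 := abs_nonpos_iff.1 ((le_max_right _ _).trans hle)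
    rw [h v h1 h2] at hv
    simp at hv)
  refine ⟨m, hm, fun v hv ↦ ?_⟩
  rcases eq_or_ne v 0 with rfl | hv0
  · simp
  have hn : 0 < ‖v‖ := norm_pos_iff.2 hv0
  have hu := hle (‖v‖⁻¹ • v) (by simp [norm_smul, hn.ne'])
  rcases le_max_iff.1 hu with h1 | h1
  · exfalso
    simp only [map_smul, smul_apply, smul_eq_mul] at h1
    have : m * ‖v‖ ^ 2 ≤ ‖v‖⁻¹ * (‖v‖⁻¹ * B v v) * ‖v‖ ^ 2 := by gcongr
    have e : ‖v‖⁻¹ * (‖v‖⁻¹ * B v v) * ‖v‖ ^ 2 = B v v := by field_simp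
    linarith
  · simp only [map_smul, smul_eq_mul, abs_mul, abs_inv, abs_norm] at h1
    have : m * ‖v‖ ≤ ‖v‖⁻¹ * |τ v| * ‖v‖ := by gcongr
    have e : ‖v‖⁻¹ * |τ v| * ‖v‖ = |τ v| := by field_simp
    linarith

/-- The causal vectors `v` at the point `q` of a vector space with a variable bilinear form `G`,
oriented by the vector field `X`. -/
def IsCausalVec (G : E → E →L[ℝ] E →L[ℝ] ℝ) (X : E → E) (q v : E) : Prop :=
  G q v v ≤ 0 ∧ G q (X q) v < 0

/-- Near a point the causal cones contain a fixed neighbourhood of a vector `T`, and the translation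
of a causal vector by `-η T` becomes causal when a suitable multiple of `T` is added. -/
theorem exists_uniform_cone [FiniteDimensional ℝ E] {G : E → E →L[ℝ] E →L[ℝ] ℝ} {X : E → E} {q₀ : E}
    (hG : ContDiffAt ℝ 1 G q₀) (hX : ContinuousAt X q₀)
    (hs : ∀ᶠ q in 𝓝 q₀, ∀ v w, G q v w = G q w v) (hneg : G q₀ (X q₀) (X q₀) < 0)
    (hnd : ∀ v, G q₀ v v ≤ 0 → G q₀ (X q₀) v = 0 → v = 0) {W : Set E} (hW : W ∈ 𝓝 q₀) :
    ∃ (τ : E →L[ℝ] ℝ) (T : E) (C ρ R : ℝ), 0 < ρ ∧ 0 < R ∧ Metric.ball q₀ R ⊆ W ∧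
      (∀ q ∈ Metric.ball q₀ R, ∀ w, ‖w - T‖ ≤ ρ → IsCausalVec G X q w) ∧
      ∀ q ∈ Metric.ball q₀ R, ∀ η : ℝ, 0 ≤ η → q - η • T ∈ Metric.ball q₀ R →
        ∀ v, IsCausalVec G X q v → IsCausalVec G X (q - η • T) (v + (η * C * τ v) • T) := by
  set T := X q₀ with hT
  set τ : E →L[ℝ] ℝ := -(G q₀ T) with hτ
  obtain ⟨m, hm, hmle⟩ := exists_pos_mul_norm_le_abs (G q₀) τ
    (fun v h1 h2 ↦ hnd v h1 (by simpa [hτ] using h2))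
  obtain ⟨K, t, ht, hK⟩ := hG.exists_lipschitzOnWith
  have hGc : ContinuousAt G q₀ := hG.continuousAt
  -- `δ` bounds the variation of `G`: `δ ≤ m` keeps nearby causal vectors in the range of `hmle`,
  -- and `δ * ‖T‖ ≤ m / 2` costs at most half of `τ v` in `hvT`.
  obtain ⟨δ, hδ, hδm, hδT⟩ : ∃ δ : ℝ, 0 < δ ∧ δ ≤ m ∧ δ * ‖T‖ ≤ m / 2 := by
    refine ⟨min m (m / 2 / (‖T‖ + 1)), by positivity, min_le_left _ _, ?_⟩
    calc min m (m / 2 / (‖T‖ + 1)) * ‖T‖ ≤ m / 2 / (‖T‖ + 1) * (‖T‖ + 1) := by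
          gcongr
          · exact min_le_right _ _
          · linarith
      _ = m / 2 := by field_simp
  have e1 : ∀ᶠ q in 𝓝 q₀, ‖G q - G q₀‖ < δ := by
    have hc : ContinuousAt (fun q ↦ K * ‖q - q₀‖) q₀ := by fun_prop
    filter_upwards [ht, hc.eventually (eventually_lt_nhds (b := δ) (by simpa using hδ))] with q hq h
    have := hK.dist_le_mul q hq q₀ (mem_of_mem_nhds ht)
    rw [dist_eq_norm, dist_eq_norm] at this
    exact this.trans_lt h
  have e2 : ∀ᶠ q in 𝓝 q₀, ‖G q (X q) + τ‖ < m / 2 := by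
    have hc : ContinuousAt (fun q ↦ G q (X q)) q₀ := hGc.clm_apply hX
    have : ∀ᶠ q in 𝓝 q₀, G q (X q) ∈ Metric.ball (G q₀ (X q₀)) (m / 2) := hc (Metric.ball_mem_nhds _ (half_pos hm))
    filter_upwards [this] with q hq
    simpa [dist_eq_norm, hτ, sub_eq_add_neg] using hq
  have e3 : ∀ᶠ p : E × E in 𝓝 (q₀, T), IsCausalVec G X p.1 p.2 := by
    have hG' : ContinuousAt (fun p : E × E ↦ G p.1) (q₀, T) :=
      ContinuousAt.comp (f := Prod.fst) hGc continuousAt_fst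
    have hX' : ContinuousAt (fun p : E × E ↦ X p.1) (q₀, T) :=
      ContinuousAt.comp (f := Prod.fst) hX continuousAt_fst
    have c1 : ContinuousAt (fun p : E × E ↦ G p.1 p.2 p.2) (q₀, T) :=
      (hG'.clm_apply continuousAt_snd).clm_apply continuousAt_snd
    have c2 : ContinuousAt (fun p : E × E ↦ G p.1 (X p.1) p.2) (q₀, T) :=
      (hG'.clm_apply hX').clm_apply continuousAt_snd
    filter_upwards [c1.eventually (eventually_lt_nhds hneg),
      c2.eventually (eventually_lt_nhds hneg)] with p h1 h2
    exact ⟨h1.le, h2⟩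
  obtain ⟨R₁, hR₁, h3⟩ := Metric.eventually_nhds_iff_ball.1 e3
  obtain ⟨R₂, hR₂, h4⟩ := Metric.eventually_nhds_iff_ball.1
    (((e1.and e2).and hs).and (Filter.inter_mem hW ht))
  have hcone : ∀ q ∈ Metric.ball q₀ (min R₁ R₂), ∀ w, ‖w - T‖ ≤ R₁ / 2 →
      IsCausalVec G X q w := by
    intro q hq w hw
    refine h3 (q, w) ?_
    rw [← ball_prod_same]
    refine ⟨Metric.ball_subset_ball (min_le_left _ _) hq, ?_⟩
    rw [mem_ball_iff_norm]
    simp only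
    linarith
  have hsub : Metric.ball q₀ (min R₁ R₂) ⊆ Metric.ball q₀ R₂ :=
    Metric.ball_subset_ball (min_le_right _ _)
  have hbd : ∀ q ∈ Metric.ball q₀ R₂, ∀ v, |G q (X q) v + τ v| ≤ m / 2 * ‖v‖ := by
    intro q hq v
    have := (G q (X q) + τ).le_opNorm v
    rw [add_apply, Real.norm_eq_abs] at this
    exact this.trans (by gcongr; exact (h4 q hq).1.1.2.le)
  have hbil : ∀ q ∈ Metric.ball q₀ R₂, ∀ v w, |G q v w - G q₀ v w| ≤ δ * ‖v‖ * ‖w‖ := by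
    intro q hq v w
    have := (G q - G q₀).le_opNorm₂ v w
    simp only [sub_apply, Real.norm_eq_abs] at this
    exact this.trans (by gcongr; exact (h4 q hq).1.1.1.le)
  have habs : ∀ q ∈ Metric.ball q₀ R₂, ∀ v, v ≠ 0 → G q v v ≤ 0 → m * ‖v‖ ≤ |τ v| := by
    intro q hq v hv h
    apply hmle
    have h1 : |G q v v - G q₀ v v| < m * ‖v‖ ^ 2 := by
      have := (G q - G q₀).le_opNorm₂ v v
      simp only [sub_apply, Real.norm_eq_abs] at this
      have hn : 0 < ‖v‖ := norm_pos_iff.2 hv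
      calc _ ≤ _ := this
        _ < m * ‖v‖ * ‖v‖ := by
          gcongr
          exact (h4 q hq).1.1.1.trans_le hδm
        _ = _ := by ring
    have := (abs_lt.1 h1).1
    linarith
  have hτpos : ∀ q ∈ Metric.ball q₀ R₂, ∀ v, IsCausalVec G X q v → v ≠ 0 ∧ m * ‖v‖ ≤ τ v := by
    intro q hq v hv
    have hv0 : v ≠ 0 := by
      rintro rfl
      simpa using hv.2
    refine ⟨hv0, ?_⟩
    have h1 := habs q hq v hv0 hv.1
    have h2 := abs_le.1 (hbd q hq v)
    have hn : 0 < ‖v‖ := norm_pos_iff.2 hv0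
    have hmn : 0 < m * ‖v‖ := by positivity
    rcases le_abs.1 h1 with h | h
    · exact h
    · linarith [h2.1, hv.2]
  have hcausal : ∀ q ∈ Metric.ball q₀ R₂, ∀ v, G q v v ≤ 0 → 0 < τ v → IsCausalVec G X q v := by
    intro q hq v h1 h2
    have hv0 : v ≠ 0 := by
      rintro rfl
      simp at h2
    have h3 := habs q hq v hv0 h1
    rw [abs_of_pos h2] at h3
    have h5 := abs_le.1 (hbd q hq v)
    have hn : 0 < m * ‖v‖ := mul_pos hm (norm_pos_iff.2 hv0)
    exact ⟨h1, by linarith [h5.2]⟩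
  -- This `C` makes the gain `s * τ v`, where `s = η * C * τ v`, equal to `K * (η * ‖T‖) * (τ v / m)
  -- ^ 2`. As `‖v‖ ≤ τ v / m`, it dominates the Lipschitz error in `hvv`.
  refine ⟨τ, T, K * ‖T‖ / m ^ 2, R₁ / 2, min R₁ R₂, by positivity, by positivity,
    fun q hq ↦ (h4 q (hsub hq)).2.1, hcone, ?_⟩
  intro q hq η hη hp v hv
  obtain ⟨hv0, hτv⟩ := hτpos q (hsub hq) v hv
  have hn : 0 < ‖v‖ := norm_pos_iff.2 hv0
  have hτv0 : 0 < τ v := lt_of_lt_of_le (by positivity) hτv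
  set p := q - η • T with hpdef
  set C : ℝ := K * ‖T‖ / m ^ 2 with hC
  have hC0 : 0 ≤ C := by positivity
  set s := η * C * τ v with hsdef
  have hs0 : 0 ≤ s := by positivity
  have hTT : G p T T ≤ 0 := (hcone p hp T (by simpa using by positivity)).1
  have hvT : G p v T ≤ -(τ v / 2) := by
    have h1 := (abs_le.1 (hbil p (hsub hp) T v)).2
    have h2 : G p v T = G p T v := (h4 p (hsub hp)).1.2 v T
    have h3 : τ v = -(G q₀ T v) := by simp [hτ]
    have h5 : δ * ‖T‖ * ‖v‖ ≤ m / 2 * ‖v‖ := by gcongr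
    linarith
  have hvv : G p v v ≤ K * (η * ‖T‖) * ‖v‖ ^ 2 := by
    have h1 := hK.dist_le_mul p (h4 p (hsub hp)).2.2 q (h4 q (hsub hq)).2.2
    rw [dist_eq_norm, dist_eq_norm, hpdef, sub_sub_cancel_left, norm_neg, norm_smul,
      Real.norm_of_nonneg hη] at h1
    have h2 := (G p - G q).le_opNorm₂ v v
    simp only [sub_apply, Real.norm_eq_abs] at h2
    have h3 : ‖G p - G q‖ * ‖v‖ * ‖v‖ ≤ K * (η * ‖T‖) * ‖v‖ * ‖v‖ := by gcongr
    have := hv.1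
    have := (abs_le.1 (h2.trans h3)).2
    nlinarith
  apply hcausal p (hsub hp)
  · have hsym : G p T v = G p v T := (h4 p (hsub hp)).1.2 T v
    have hexp : G p (v + s • T) (v + s • T) = G p v v + 2 * s * G p v T + s ^ 2 * G p T T := by
      simp only [map_add, map_smul, add_apply, smul_apply,
        smul_eq_mul, hsym]
      ring
    rw [hexp]
    have h1 : 2 * s * G p v T ≤ 2 * s * (-(τ v / 2)) := by gcongr
    have h2 : s ^ 2 * G p T T ≤ 0 := mul_nonpos_of_nonneg_of_nonpos (sq_nonneg s) hTT
    have h3 : K * (η * ‖T‖) * ‖v‖ ^ 2 ≤ s * τ v := by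
      have e : s * τ v = K * (η * ‖T‖) * (τ v / m) ^ 2 := by
        rw [hsdef, hC]
        field_simp
      rw [e]
      gcongr
      rw [le_div_iff₀ hm]
      linarith
    linarith
  · have : τ (v + s • T) = τ v + s * τ T := by simp
    rw [this]
    have : 0 < τ T := by simpa [hτ] using hneg
    positivity

/-- A vector orthogonal to a timelike vector of a Lorentzian form is spacelike or zero. -/
theorem eq_zero_of_lorentzian {V : Type*} [AddCommGroup V] [Module ℝ V] {n : ℕ}
    (B : V →ₗ[ℝ] V →ₗ[ℝ] ℝ) (e : Module.Basis (Fin n) ℝ V)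
    (he : ∀ i j, B (e i) (e j) = if i = j then (if (i : ℕ) = 0 then -1 else 1) else 0)
    {t v : V} (ht : B t t < 0) (hv : B v v ≤ 0) (htv : B t v = 0) : v = 0 := by
  have hB : ∀ a b : V, B a b = ∑ i, e.repr a i * e.repr b i * (if (i : ℕ) = 0 then -1 else 1) := by
    intro a b
    conv_lhs => rw [← e.sum_repr a, ← e.sum_repr b]
    simp only [map_sum, LinearMap.sum_apply, map_smul, LinearMap.smul_apply, he, smul_eq_mul]
    simp [mul_comm]
  rcases n with _ | n
  · simp [hB] at ht
  simp only [hB, Fin.sum_univ_succ, Fin.val_succ, Fin.val_zero, if_true, Nat.succ_ne_zero,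
    if_false, mul_one] at ht hv htv
  have hcs := Finset.sum_mul_sq_le_sq_mul_sq Finset.univ (fun i : Fin n ↦ e.repr t i.succ)
    (fun i ↦ e.repr v i.succ)
  simp only [pow_two] at hcs
  set A := ∑ i : Fin n, e.repr t i.succ * e.repr t i.succ
  set D := ∑ i : Fin n, e.repr v i.succ * e.repr v i.succ with hD
  have hA : 0 ≤ A := Finset.sum_nonneg fun i _ ↦ mul_self_nonneg _
  have hD0 : 0 ≤ D := Finset.sum_nonneg fun i _ ↦ mul_self_nonneg _
  -- Reversed Cauchy–Schwarz: orthogonality equates the time part `t₀ v₀` with the spatial product,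
  -- whose square is at most `A * D ≤ A * v₀²`, and this is less than `t₀² v₀²` if `v₀ ≠ 0`.
  have hz : e.repr v 0 = 0 := by
    by_contra h
    have h2 : 0 < e.repr v 0 * e.repr v 0 := mul_self_pos.2 h
    have h1 : (∑ i : Fin n, e.repr t i.succ * e.repr v i.succ) = e.repr t 0 * e.repr v 0 := by
      linarith
    rw [h1] at hcs
    have h3 : A * D ≤ A * (e.repr v 0 * e.repr v 0) := by
      gcongr
      linarith
    have h4 : A * (e.repr v 0 * e.repr v 0) <
        (e.repr t 0 * e.repr t 0) * (e.repr v 0 * e.repr v 0) := by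
      gcongr
      linarith
    linarith
  have hDz : D = 0 := by
    rw [hz] at hv
    linarith
  rw [hD, Finset.sum_eq_zero_iff_of_nonneg fun i _ ↦ mul_self_nonneg _] at hDz
  apply e.repr.injective
  ext i
  refine Fin.cases ?_ (fun i ↦ ?_) i
  · simpa using hz
  · simpa using hDz i (Finset.mem_univ i)

end UniformCone

/-- A path that leaves a closed set `K` hits the frontier of `K` at a first time, before which it
stays in `K`. -/
theorem exists_first_mem_frontier {X : Type*} [TopologicalSpace X] {γ : ℝ → X} {a b : ℝ} {K : Set X}
    (hab : a ≤ b) (hγ : ContinuousOn γ (Icc a b)) (hK : IsClosed K) (ha : γ a ∈ K) (hb : γ b ∉ K) :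
    ∃ s ∈ Icc a b, γ s ∈ frontier K ∧ ∀ t ∈ Icc a s, γ t ∈ K := by
  have key : ∀ c ∈ Icc a b, γ c ∉ K → ∃ t ∈ Icc a c, γ t ∈ frontier K := by
    intro c hc hcK
    by_contra! hf
    have hpre : IsPreconnected (γ '' Icc a c) :=
      isPreconnected_Icc.image γ (hγ.mono (Icc_subset_Icc_right hc.2))
    obtain ⟨_, ⟨t, ht, rfl⟩, hi, hKc⟩ := hpre (interior K) Kᶜ isOpen_interior hK.isOpen_compl
      (by
        rintro _ ⟨t, ht, rfl⟩
        by_contra! h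
        refine hf t ht (hK.frontier_eq ▸ ⟨?_, ?_⟩)
        · by_contra hn
          exact h (Or.inr hn)
        · exact fun hn ↦ h (Or.inl hn))
      ⟨γ a, mem_image_of_mem γ (left_mem_Icc.2 hc.1), by
        by_contra hn
        exact hf a (left_mem_Icc.2 hc.1) (hK.frontier_eq ▸ ⟨ha, hn⟩)⟩
      ⟨γ c, mem_image_of_mem γ (right_mem_Icc.2 hc.1), hcK⟩
    exact hKc (interior_subset hi)
  have hcpt : IsCompact (Icc a b ∩ γ ⁻¹' frontier K) :=
    isCompact_Icc.of_isClosed_subset (hγ.preimage_isClosed_of_isClosed isClosed_Icc isClosed_frontier)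
      inter_subset_left
  obtain ⟨t, ht, htf⟩ := key b (right_mem_Icc.2 hab) hb
  obtain ⟨s, ⟨hs, hsf⟩, hmin⟩ := hcpt.exists_isLeast ⟨t, ht, htf⟩
  refine ⟨s, hs, hsf, fun t ht ↦ ?_⟩
  by_contra htK
  obtain ⟨u, hu, huf⟩ := key t ⟨ht.1, ht.2.trans hs.2⟩ htK
  have hsu := hmin ⟨⟨hu.1, hu.2.trans (ht.2.trans hs.2)⟩, huf⟩
  obtain rfl : t = s := le_antisymm ht.2 (hsu.trans hu.2)
  exact htK (hK.frontier_subset hsf)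

/-! ### Restriction, concatenation and reparametrization of causal curves. -/

namespace Spacetime

variable {n : ℕ} {r : ℕ∞} {M : Type*} [TopologicalSpace M]
  [ChartedSpace (EuclideanSpace ℝ (Fin n)) M] [IsManifold (𝓡 n) 1 M] {S : Spacetime n r M}
  {γ γ₁ γ₂ : ℝ → M} {a b c d : ℝ}

/-- Derivatives within a nondegenerate interval are unique, so any derivative may serve as the
velocity. This form passes easily through restriction, congruence and composition. -/
theorem isCausalSegment_iff : S.IsCausalSegment γ a b ↔
    a < b ∧ ContMDiffOn 𝓘(ℝ, ℝ) (𝓡 n) 1 γ (Icc a b) ∧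
      ∀ t ∈ Icc a b, ∃ L, HasMFDerivWithinAt 𝓘(ℝ, ℝ) (𝓡 n) γ (Icc a b) t L ∧
        S.IsFutureCausal (show TangentSpace (𝓡 n) (γ t) from L (1 : ℝ)) := by
  refine and_congr_right fun hab ↦ and_congr_right fun hγ ↦ forall₂_congr fun t ht ↦ ?_
  have h := ((hγ t ht).mdifferentiableWithinAt one_ne_zero).hasMFDerivWithinAt
  refine ⟨fun hc ↦ ⟨_, h, hc⟩, ?_⟩
  rintro ⟨L, hL, hc⟩
  have hu : UniqueMDiffWithinAt 𝓘(ℝ, ℝ) (Icc a b) t :=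
    uniqueMDiffWithinAt_iff_uniqueDiffWithinAt.2 (uniqueDiffOn_Icc hab t ht)
  rwa [hL.mfderivWithin hu]

theorem IsCausalSegment.lt (h : S.IsCausalSegment γ a b) : a < b := h.1

theorem IsCausalSegment.continuousOn (h : S.IsCausalSegment γ a b) : ContinuousOn γ (Icc a b) :=
  h.2.1.continuousOn

theorem isFutureCausal_congr {p q : M} (h : p = q) (v : EuclideanSpace ℝ (Fin n))
    (hv : S.IsFutureCausal (show TangentSpace (𝓡 n) p from v)) :
    S.IsFutureCausal (show TangentSpace (𝓡 n) q from v) := by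
  subst h
  exact hv

theorem IsCausalSegment.congr (h : S.IsCausalSegment γ a b) (he : EqOn γ₁ γ (Icc a b)) :
    S.IsCausalSegment γ₁ a b := by
  rw [isCausalSegment_iff] at h ⊢
  refine ⟨h.1, h.2.1.congr he, fun t ht ↦ ?_⟩
  obtain ⟨L, hL, hc⟩ := h.2.2 t ht
  exact ⟨L, hL.congr_of_eventuallyEq (Filter.eventuallyEq_of_mem self_mem_nhdsWithin he) (he ht),
    isFutureCausal_congr (he ht).symm _ hc⟩

theorem IsCausalSegment.mono (h : S.IsCausalSegment γ a b) (hac : a ≤ c) (hcd : c < d)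
    (hdb : d ≤ b) : S.IsCausalSegment γ c d := by
  rw [isCausalSegment_iff] at h ⊢
  have hsub : Icc c d ⊆ Icc a b := Icc_subset_Icc hac hdb
  refine ⟨hcd, h.2.1.mono hsub, fun t ht ↦ ?_⟩
  obtain ⟨L, hL, hc⟩ := h.2.2 t (hsub ht)
  exact ⟨L, hL.mono hsub, hc⟩

theorem IsCausalSegment.comp_add_const (h : S.IsCausalSegment γ a b) (s : ℝ) :
    S.IsCausalSegment (fun t ↦ γ (t + s)) (a - s) (b - s) := by
  rw [isCausalSegment_iff] at h ⊢
  have hmaps : MapsTo (fun t ↦ t + s) (Icc (a - s) (b - s)) (Icc a b) := fun t ht ↦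
    ⟨by linarith [ht.1], by linarith [ht.2]⟩
  refine ⟨by linarith [h.1], ?_, fun t ht ↦ ?_⟩
  · have : ContMDiffOn 𝓘(ℝ, ℝ) 𝓘(ℝ, ℝ) 1 (fun t : ℝ ↦ t + s) (Icc (a - s) (b - s)) := by
      apply ContDiffOn.contMDiffOn
      fun_prop
    exact h.2.1.comp this hmaps
  · obtain ⟨L, hL, hc⟩ := h.2.2 _ (hmaps ht)
    have hd : HasFDerivWithinAt (fun t : ℝ ↦ t + s) (ContinuousLinearMap.id ℝ ℝ)
        (Icc (a - s) (b - s)) t := (hasFDerivWithinAt_id t _).add_const s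
    exact ⟨_, HasMFDerivWithinAt.comp t hL hd.hasMFDerivWithinAt hmaps, hc⟩

theorem IsCausalSegment.isCausalCurve (h : S.IsCausalSegment γ a b) : S.IsCausalCurve γ a b := by
  refine ⟨1, fun i ↦ if i = 0 then a else b, one_pos, by simp, by simp, fun i hi ↦ ?_⟩
  obtain rfl : i = 0 := by omega
  simpa using h

theorem IsCausalCurve.snoc (h : S.IsCausalCurve γ a b) (h' : S.IsCausalSegment γ b c) :
    S.IsCausalCurve γ a c := by
  obtain ⟨k, t, hk, h0, hb, ht⟩ := h
  refine ⟨k + 1, fun i ↦ if i ≤ k then t i else c, by omega, by simp [h0], by simp,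
    fun i hi ↦ ?_⟩
  rcases Nat.lt_succ_iff_lt_or_eq.1 hi with hi | rfl
  · simpa [hi.le, Nat.succ_le_iff.2 hi] using ht i hi
  · simpa [hb] using h'

/-- The partition is consumed from the left with `a` fixed, so facts about curves reduce to facts
about one segment. -/
theorem IsCausalCurve.induction {P : ℝ → Prop} (h : S.IsCausalCurve γ a b)
    (hseg : ∀ b, S.IsCausalSegment γ a b → P b)
    (hsnoc : ∀ c b, S.IsCausalCurve γ a c → S.IsCausalSegment γ c b → P c → P b) : P b := by
  obtain ⟨k, t, hk, h0, rfl, ht⟩ := h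
  have key : ∀ i, i < k → S.IsCausalCurve γ a (t (i + 1)) ∧ P (t (i + 1)) := by
    intro i
    induction i with
    | zero =>
      intro hi
      have := ht 0 hi
      rw [h0] at this
      exact ⟨this.isCausalCurve, hseg _ this⟩
    | succ i ih =>
      intro hi
      obtain ⟨h1, h2⟩ := ih (by omega)
      exact ⟨h1.snoc (ht _ hi), hsnoc _ _ h1 (ht _ hi) h2⟩
  obtain ⟨j, rfl⟩ : ∃ j, k = j + 1 := ⟨k - 1, by omega⟩
  exact (key j (by omega)).2

theorem IsCausalCurve.trans (h : S.IsCausalCurve γ a b) (h' : S.IsCausalCurve γ b c) :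
    S.IsCausalCurve γ a c :=
  h'.induction (fun _ ↦ h.snoc) (fun _ _ _ hs hc ↦ hc.snoc hs)

theorem IsCausalCurve.lt (h : S.IsCausalCurve γ a b) : a < b :=
  h.induction (fun _ hs ↦ hs.lt) (fun _ _ _ hs hc ↦ hc.trans hs.lt)

theorem IsCausalCurve.continuousOn (h : S.IsCausalCurve γ a b) : ContinuousOn γ (Icc a b) := by
  refine h.induction (fun _ hs ↦ hs.continuousOn) (fun c b h hs hc ↦ ?_)
  rw [← Icc_union_Icc_eq_Icc h.lt.le hs.lt.le]
  exact hc.union_of_isClosed hs.continuousOn isClosed_Icc isClosed_Icc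

/-- A map that sends causal segments in `N` to causal segments does so for causal curves. -/
theorem IsCausalCurve.map (h : S.IsCausalCurve γ a b) {N : Set M} {F : M → M}
    (hF : ∀ a b, S.IsCausalSegment γ a b → MapsTo γ (Icc a b) N →
      S.IsCausalSegment (F ∘ γ) a b) (hN : MapsTo γ (Icc a b) N) :
    S.IsCausalCurve (F ∘ γ) a b := by
  revert hN
  refine h.induction (fun b hs hN ↦ (hF _ _ hs hN).isCausalCurve) (fun c b h hs hc hN ↦ ?_)
  exact (hc (hN.mono_left (Icc_subset_Icc_right hs.lt.le))).snoc
    (hF _ _ hs (hN.mono_left (Icc_subset_Icc_left h.lt.le)))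

theorem IsCausalCurve.congr (h : S.IsCausalCurve γ a b) (he : EqOn γ₁ γ (Icc a b)) :
    S.IsCausalCurve γ₁ a b := by
  revert he
  refine h.induction (fun b hs he ↦ (hs.congr he).isCausalCurve) (fun c b h hs hc he ↦ ?_)
  exact (hc (he.mono (Icc_subset_Icc_right hs.lt.le))).snoc
    (hs.congr (he.mono (Icc_subset_Icc_left h.lt.le)))

theorem IsCausalCurve.comp_add_const (h : S.IsCausalCurve γ a b) (s : ℝ) :
    S.IsCausalCurve (fun t ↦ γ (t + s)) (a - s) (b - s) :=
  h.induction (P := fun b ↦ S.IsCausalCurve (fun t ↦ γ (t + s)) (a - s) (b - s))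
    (fun _ hs ↦ (hs.comp_add_const s).isCausalCurve)
    (fun _ _ _ hs hc ↦ hc.snoc (hs.comp_add_const s))

theorem IsCausalCurve.restrict_left (h : S.IsCausalCurve γ a b) (hac : a < c) (hcb : c ≤ b) :
    S.IsCausalCurve γ a c := by
  suffices key : ∀ c, a < c → c ≤ b → S.IsCausalCurve γ a c from key c hac hcb
  refine h.induction (P := fun b ↦ ∀ c, a < c → c ≤ b → S.IsCausalCurve γ a c) (fun b hs c hac hcb ↦ (hs.mono le_rfl hac hcb).isCausalCurve)
    (fun d b h hs ih c hac hcb ↦ ?_)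
  rcases le_or_gt c d with hcd | hcd
  · exact ih c hac hcd
  · exact h.snoc (hs.mono le_rfl hcd hcb)

theorem IsCausalCurve.restrict_right (h : S.IsCausalCurve γ a b) (hac : a ≤ c) (hcb : c < b) :
    S.IsCausalCurve γ c b := by
  suffices key : ∀ c, a ≤ c → c < b → S.IsCausalCurve γ c b from key c hac hcb
  refine h.induction (P := fun b ↦ ∀ c, a ≤ c → c < b → S.IsCausalCurve γ c b) (fun b hs c hac hcb ↦ (hs.mono hac hcb le_rfl).isCausalCurve)
    (fun d b h hs ih c hac hcb ↦ ?_)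
  rcases lt_or_ge c d with hcd | hcd
  · exact (ih c hac hcd).snoc hs
  · exact (hs.mono hcd hcb le_rfl).isCausalCurve

theorem IsCausalCurve.left_mem_JPlus (h : S.IsCausalCurve γ a b) (hc : c ∈ Icc a b) :
    (γ a, γ c) ∈ S.JPlus := by
  rcases hc.1.eq_or_lt with rfl | hac
  · exact Or.inl rfl
  · exact Or.inr ⟨γ, a, c, h.restrict_left hac hc.2, rfl, rfl⟩

theorem IsCausalCurve.mem_JPlus_right (h : S.IsCausalCurve γ a b) (hc : c ∈ Icc a b) :
    (γ c, γ b) ∈ S.JPlus := by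
  rcases hc.2.eq_or_lt with rfl | hcb
  · exact Or.inl rfl
  · exact Or.inr ⟨γ, c, b, h.restrict_right hc.1 hcb, rfl, rfl⟩

/-- The junction time `b` is kept in the conclusion because strong causality will be applied at the
junction point. -/
theorem IsCausalCurve.exists_concat (h₁ : S.IsCausalCurve γ₁ a b) (h₂ : S.IsCausalCurve γ₂ c d)
    (he : γ₁ b = γ₂ c) : ∃ (γ : ℝ → M) (e : ℝ), b ≤ e ∧ S.IsCausalCurve γ a e ∧
      γ a = γ₁ a ∧ γ b = γ₁ b ∧ γ e = γ₂ d := by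
  have hab := h₁.lt
  have hcd := h₂.lt
  set γ : ℝ → M := fun t ↦ if t ≤ b then γ₁ t else γ₂ (t + (c - b)) with hγ
  have e₁ : EqOn γ γ₁ (Icc a b) := fun t ht ↦ if_pos ht.2
  have h₃ := h₂.comp_add_const (c - b)
  rw [sub_sub_cancel] at h₃
  have e₂ : EqOn γ (fun t ↦ γ₂ (t + (c - b))) (Icc b (d - (c - b))) := by
    intro t ht
    rcases ht.1.eq_or_lt with rfl | hlt
    · simp [hγ, he]
    · exact if_neg hlt.not_ge
  refine ⟨γ, d - (c - b), by linarith, (h₁.congr e₁).trans (h₃.congr e₂),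
    e₁ (left_mem_Icc.2 hab.le), e₁ (right_mem_Icc.2 hab.le), ?_⟩
  rw [e₂ (right_mem_Icc.2 (by linarith))]
  simp

theorem JPlus_trans {p q w : M} (hpq : (p, q) ∈ S.JPlus) (hqw : (q, w) ∈ S.JPlus) :
    (p, w) ∈ S.JPlus := by
  rcases hpq with hpq | ⟨γ₁, a, b, h₁, h₁a, h₁b⟩
  · exact (show p = q from hpq) ▸ hqw
  rcases hqw with hqw | ⟨γ₂, c, d, h₂, h₂c, h₂d⟩
  · exact (show q = w from hqw) ▸ Or.inr ⟨γ₁, a, b, h₁, h₁a, h₁b⟩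
  obtain ⟨γ, e, _, hγ, ha, _, he⟩ := h₁.exists_concat h₂ (h₁b.trans h₂c.symm)
  exact Or.inr ⟨γ, a, e, hγ, ha.trans h₁a, he.trans h₂d⟩

/-- In a strongly causal spacetime, causal diamonds with vertices near `x` are small. -/
theorem StronglyCausal.exists_nhds (hS : S.StronglyCausal) {x : M} {U : Set M} (hU : U ∈ 𝓝 x) :
    ∃ V ∈ 𝓝 x, ∀ p q w, p ∈ V → w ∈ V → (p, q) ∈ S.JPlus → (q, w) ∈ S.JPlus → q ∈ U := by
  obtain ⟨V, hV, hVU, h⟩ := hS x U hU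
  refine ⟨V, hV, fun p q w hp hw hpq hqw ↦ ?_⟩
  rcases hpq with hpq | ⟨γ₁, a, b, h₁, h₁a, h₁b⟩
  · exact hVU ((show p = q from hpq) ▸ hp)
  rcases hqw with hqw | ⟨γ₂, c, d, h₂, h₂c, h₂d⟩
  · exact hVU ((show q = w from hqw) ▸ hw)
  obtain ⟨γ, e, hbe, hγ, ha, hb, he⟩ := h₁.exists_concat h₂ (h₁b.trans h₂c.symm)
  have := h γ a e hγ (by rwa [ha, h₁a]) (by rwa [he, h₂d]) b ⟨h₁.lt.le, hbe⟩
  rwa [hb, h₁b] at this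

end Spacetime

/-! ### The metric, the time orientation and causal segments in a chart. -/

namespace Spacetime

variable {n : ℕ} {r : ℕ∞} {M : Type*} [TopologicalSpace M]
  [ChartedSpace (EuclideanSpace ℝ (Fin n)) M] [IsManifold (𝓡 n) 1 M] {S : Spacetime n r M}
  {γ : ℝ → M} {a b : ℝ}

/-- The metric at `p`, read in the trivialization of the tangent bundle at `x`. -/
noncomputable def localMetric (S : Spacetime n r M) (x p : M) :
    EuclideanSpace ℝ (Fin n) →L[ℝ] EuclideanSpace ℝ (Fin n) →L[ℝ] ℝ :=
  (((trivializationAt (EuclideanSpace ℝ (Fin n)) (TangentSpace (𝓡 n)) x).symmL ℝ p).precomp ℝ).comp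
    ((S.g p).comp ((trivializationAt (EuclideanSpace ℝ (Fin n)) (TangentSpace (𝓡 n)) x).symmL ℝ p))

/-- The time orientation at `p`, read in the trivialization of the tangent bundle at `x`. -/
noncomputable def localField (S : Spacetime n r M) (x p : M) : EuclideanSpace ℝ (Fin n) :=
  (trivializationAt (EuclideanSpace ℝ (Fin n)) (TangentSpace (𝓡 n)) x).continuousLinearMapAt ℝ p
    (S.timeField p)

/-- The metric in the coordinates given by the preferred chart at `x`. -/
noncomputable def coordMetric (S : Spacetime n r M) (x : M) (q : EuclideanSpace ℝ (Fin n)) :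
    EuclideanSpace ℝ (Fin n) →L[ℝ] EuclideanSpace ℝ (Fin n) →L[ℝ] ℝ :=
  S.localMetric x ((extChartAt (𝓡 n) x).symm q)

/-- The time orientation in the coordinates given by the preferred chart at `x`. -/
noncomputable def coordField (S : Spacetime n r M) (x : M) (q : EuclideanSpace ℝ (Fin n)) :
    EuclideanSpace ℝ (Fin n) :=
  S.localField x ((extChartAt (𝓡 n) x).symm q)

theorem localMetric_apply (x p : M) (v w : EuclideanSpace ℝ (Fin n)) :
    S.localMetric x p v w = S.g p
      ((trivializationAt (EuclideanSpace ℝ (Fin n)) (TangentSpace (𝓡 n)) x).symmL ℝ p v)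
      ((trivializationAt (EuclideanSpace ℝ (Fin n)) (TangentSpace (𝓡 n)) x).symmL ℝ p w) := rfl

theorem mem_baseSet {x p : M} (hp : p ∈ (extChartAt (𝓡 n) x).source) :
    p ∈ (trivializationAt (EuclideanSpace ℝ (Fin n)) (TangentSpace (𝓡 n)) x).baseSet := by
  simpa using hp

theorem symmL_localField {x p : M} (hp : p ∈ (extChartAt (𝓡 n) x).source) :
    (trivializationAt (EuclideanSpace ℝ (Fin n)) (TangentSpace (𝓡 n)) x).symmL ℝ p
      (S.localField x p) = S.timeField p :=
  Bundle.Trivialization.symmL_continuousLinearMapAt _ (mem_baseSet hp) _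

theorem isFutureCausal_symmL_iff {x : M} {q : EuclideanSpace ℝ (Fin n)}
    (hq : q ∈ (extChartAt (𝓡 n) x).target) (v : EuclideanSpace ℝ (Fin n)) :
    IsCausalVec (S.coordMetric x) (S.coordField x) q v ↔
      S.IsFutureCausal ((trivializationAt (EuclideanSpace ℝ (Fin n)) (TangentSpace (𝓡 n)) x).symmL ℝ
        ((extChartAt (𝓡 n) x).symm q) v) := by
  have hp := (extChartAt (𝓡 n) x).map_target hq
  simp only [IsCausalVec, IsFutureCausal, coordMetric, coordField, localMetric_apply,
    symmL_localField hp]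

theorem isCausalVec_continuousLinearMapAt {x p : M} (hp : p ∈ (extChartAt (𝓡 n) x).source)
    {w : TangentSpace (𝓡 n) p} (hw : S.IsFutureCausal w) :
    IsCausalVec (S.coordMetric x) (S.coordField x) (extChartAt (𝓡 n) x p)
      ((trivializationAt (EuclideanSpace ℝ (Fin n)) (TangentSpace (𝓡 n)) x).continuousLinearMapAt
        ℝ p w) := by
  simp only [IsCausalVec, coordMetric, coordField, (extChartAt (𝓡 n) x).left_inv hp,
    localMetric_apply, symmL_localField hp,
    Bundle.Trivialization.symmL_continuousLinearMapAt _ (mem_baseSet hp)]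
  exact hw

theorem coordMetric_symm (x : M) (q v w : EuclideanSpace ℝ (Fin n)) :
    S.coordMetric x q v w = S.coordMetric x q w v :=
  S.symm _ _ _

theorem coordMetric_coordField_neg {x : M} {q : EuclideanSpace ℝ (Fin n)}
    (hq : q ∈ (extChartAt (𝓡 n) x).target) :
    S.coordMetric x q (S.coordField x q) (S.coordField x q) < 0 := by
  have hp := (extChartAt (𝓡 n) x).map_target hq
  simp only [coordMetric, coordField, localMetric_apply, symmL_localField hp]
  exact S.timelike_timeField _

theorem coordMetric_nondegenerate {x : M} {q : EuclideanSpace ℝ (Fin n)}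
    (hq : q ∈ (extChartAt (𝓡 n) x).target) (v : EuclideanSpace ℝ (Fin n))
    (hv : S.coordMetric x q v v ≤ 0) (hvX : S.coordMetric x q (S.coordField x q) v = 0) :
    v = 0 := by
  have hp := (extChartAt (𝓡 n) x).map_target hq
  set p := (extChartAt (𝓡 n) x).symm q with hpq
  simp only [coordMetric, coordField, localMetric_apply, ← hpq, symmL_localField hp] at hv hvX
  obtain ⟨e, he⟩ := S.signature p
  let B : TangentSpace (𝓡 n) p →ₗ[ℝ] TangentSpace (𝓡 n) p →ₗ[ℝ] ℝ :=
    LinearMap.mk₂ ℝ (fun v w ↦ S.g p v w) (by simp) (by simp) (by simp) (by simp)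
  have h0 := eq_zero_of_lorentzian B e he (S.timelike_timeField p) hv hvX
  have := (trivializationAt (EuclideanSpace ℝ (Fin n))
    (TangentSpace (𝓡 n)) x).continuousLinearMapAt_symmL (R := ℝ) (mem_baseSet hp) v
  rw [h0, map_zero] at this
  exact this.symm

theorem continuousOn_coordField (x : M) :
    ContinuousOn (S.coordField x) (extChartAt (𝓡 n) x).target := by
  have h1 : ContinuousOn (S.localField x) (extChartAt (𝓡 n) x).source := by
    have h2 : ContinuousOn (fun p ↦ ((trivializationAt (EuclideanSpace ℝ (Fin n))
        (TangentSpace (𝓡 n)) x) ⟨p, S.timeField p⟩).2) (extChartAt (𝓡 n) x).source := by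
      refine continuous_snd.comp_continuousOn
        ((trivializationAt (EuclideanSpace ℝ (Fin n)) (TangentSpace (𝓡 n)) x).continuousOn.comp
          S.continuous_timeField.continuousOn fun p hp ↦ ?_)
      exact (Bundle.Trivialization.mem_source _).2 (mem_baseSet hp)
    refine h2.congr fun p hp ↦ ?_
    exact Bundle.Trivialization.continuousLinearMapAt_apply_of_mem (R := ℝ) _ (mem_baseSet hp) _
  exact h1.comp (continuousOn_extChartAt_symm x) (extChartAt (𝓡 n) x).mapsTo_symm

/-- The metric is evaluated on the fields that are constant in the trivialization. Class `C^1`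
supplies the local Lipschitz bound behind `exists_uniform_cone`. -/
theorem contDiffOn_coordMetric (hr : 2 ≤ r) (x : M) :
    ContDiffOn ℝ 1 (S.coordMetric x) (extChartAt (𝓡 n) x).target := by
  have : IsManifold (𝓡 n) 2 M := by
    have := S.isManifold
    exact IsManifold.of_le (n := (r : WithTop ℕ∞)) (WithTop.coe_le_coe.2 hr)
  have : IsManifold (𝓡 n) (1 + 1) M := by
    rwa [one_add_one_eq_two]
  have : ContMDiffVectorBundle 1 (EuclideanSpace ℝ (Fin n)) (TangentSpace (𝓡 n) : M → Type _)
    (𝓡 n) := inferInstance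
  have hle : (1 : WithTop ℕ∞) ≤ ((r - 1 : ℕ∞) : WithTop ℕ∞) := by
    have : (1 : ℕ∞) ≤ r - 1 := by
      rw [← one_add_one_eq_two] at hr
      exact ENat.le_sub_of_add_le_right (by simp) hr
    exact_mod_cast this
  have hg := S.contMDiff.of_le hle
  simp_rw [contDiffOn_clm_apply]
  intro v w
  have hconst : ∀ v : EuclideanSpace ℝ (Fin n), ∀ p ∈ (extChartAt (𝓡 n) x).source,
      ContMDiffAt (𝓡 n) ((𝓡 n).prod 𝓘(ℝ, EuclideanSpace ℝ (Fin n))) 1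
        (fun p ↦ Bundle.TotalSpace.mk' (EuclideanSpace ℝ (Fin n)) p
          ((trivializationAt (EuclideanSpace ℝ (Fin n)) (TangentSpace (𝓡 n)) x).symmL ℝ p v)) p := by
    intro v p hp
    rw [Bundle.Trivialization.contMDiffAt_section_iff _ (mem_baseSet hp)]
    refine (contMDiffAt_const (c := v)).congr_of_eventuallyEq ?_
    filter_upwards [(isOpen_extChartAt_source x).mem_nhds hp] with p' hp'
    rw [← Bundle.Trivialization.continuousLinearMapAt_apply_of_mem (R := ℝ) _ (mem_baseSet hp')]
    exact Bundle.Trivialization.continuousLinearMapAt_symmL _ (mem_baseSet hp') v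
  have hsc : ContMDiffOn (𝓡 n) 𝓘(ℝ, ℝ) 1 (fun p ↦ S.localMetric x p v w)
      (extChartAt (𝓡 n) x).source := by
    intro p hp
    have := (hg p).clm_bundle_apply₂ (F₁ := EuclideanSpace ℝ (Fin n))
      (F₂ := EuclideanSpace ℝ (Fin n)) (F₃ := ℝ) (E₃ := Bundle.Trivial M ℝ)
      (hconst v p hp) (hconst w p hp)
    rw [Bundle.contMDiffAt_section] at this
    exact this.contMDiffWithinAt
  exact (hsc.comp (contMDiffOn_extChartAt_symm x) (extChartAt (𝓡 n) x).mapsTo_symm).contDiffOn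

/-- A causal segment of class `C^1` in a vector space with a variable bilinear form `G`, oriented by
the vector field `X`. -/
def IsCoordCausalSegment {E : Type*} [NormedAddCommGroup E] [NormedSpace ℝ E]
    (G : E → E →L[ℝ] E →L[ℝ] ℝ) (X : E → E) (c : ℝ → E) (a b : ℝ) : Prop :=
  a < b ∧ ContDiffOn ℝ 1 c (Icc a b) ∧
    ∀ t ∈ Icc a b, ∃ v, HasDerivWithinAt c v (Icc a b) t ∧ IsCausalVec G X (c t) v

theorem IsCausalSegment.extChartAt_comp {x : M} (h : S.IsCausalSegment γ a b)
    (hγ : MapsTo γ (Icc a b) (extChartAt (𝓡 n) x).source) :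
    IsCoordCausalSegment (S.coordMetric x) (S.coordField x) (extChartAt (𝓡 n) x ∘ γ) a b := by
  rw [isCausalSegment_iff] at h
  refine ⟨h.1, ((contMDiffOn_extChartAt (n := 1)).comp h.2.1 ?_).contDiffOn, fun t ht ↦ ?_⟩
  · exact fun t ht ↦ by simpa using hγ ht
  · obtain ⟨L, hL, hc⟩ := h.2.2 t ht
    have hp := hγ ht
    have hp' : γ t ∈ (chartAt (EuclideanSpace ℝ (Fin n)) x).source := by simpa using hp
    have hd := (mdifferentiableAt_extChartAt (I := 𝓡 n) hp').hasMFDerivAt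
    -- The derivative of the chart is the trivialization of the tangent bundle, so velocities
    -- correspond in the way `coordMetric` prescribes.
    rw [← TangentBundle.continuousLinearMapAt_trivializationAt hp'] at hd
    let D : ℝ →L[ℝ] EuclideanSpace ℝ (Fin n) := ((trivializationAt (EuclideanSpace ℝ (Fin n))
      (TangentSpace (𝓡 n)) x).continuousLinearMapAt ℝ (γ t)).comp L
    have hD : HasFDerivWithinAt (extChartAt (𝓡 n) x ∘ γ) D (Icc a b) t :=
      hasMFDerivWithinAt_iff_hasFDerivWithinAt.1 (hd.comp_hasMFDerivWithinAt t hL)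
    exact ⟨_, hD.hasDerivWithinAt, isCausalVec_continuousLinearMapAt hp hc⟩

theorem IsCoordCausalSegment.extChartAt_symm_comp {x : M} {c : ℝ → EuclideanSpace ℝ (Fin n)}
    (h : IsCoordCausalSegment (S.coordMetric x) (S.coordField x) c a b)
    (hc : MapsTo c (Icc a b) (extChartAt (𝓡 n) x).target) :
    S.IsCausalSegment ((extChartAt (𝓡 n) x).symm ∘ c) a b := by
  rw [isCausalSegment_iff]
  refine ⟨h.1, (contMDiffOn_extChartAt_symm x).comp h.2.1.contMDiffOn hc, fun t ht ↦ ?_⟩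
  obtain ⟨v, hv, hcv⟩ := h.2.2 t ht
  have hp := (extChartAt (𝓡 n) x).map_target (hc ht)
  have hp' : (extChartAt (𝓡 n) x).symm (c t) ∈ (chartAt (EuclideanSpace ℝ (Fin n)) x).source := by
    simpa using hp
  have hd := (mdifferentiableWithinAt_extChartAt_symm (I := 𝓡 n) (hc ht)).hasMFDerivWithinAt
  have hsymm := TangentBundle.symmL_trivializationAt (I := 𝓡 n) (𝕜 := ℝ) hp'
  rw [(extChartAt (𝓡 n) x).right_inv (hc ht)] at hsymm
  rw [← hsymm] at hd
  refine ⟨_, hd.comp t hv.hasFDerivWithinAt.hasMFDerivWithinAt fun t _ ↦ by simp, ?_⟩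
  change S.IsFutureCausal ((trivializationAt (EuclideanSpace ℝ (Fin n)) (TangentSpace (𝓡 n)) x).symmL
    ℝ ((extChartAt (𝓡 n) x).symm (c t)) ((1 : ℝ) • v))
  rw [one_smul]
  exact (isFutureCausal_symmL_iff (hc ht) v).1 hcv

end Spacetime

/-! ### Pushing coordinate curves to the past. -/

section Push

variable {E : Type*} [NormedAddCommGroup E] [NormedSpace ℝ E] {G : E → E →L[ℝ] E →L[ℝ] ℝ}
  {X : E → E}

theorem IsCausalVec.smul {q v : E} (h : IsCausalVec G X q v) {s : ℝ} (hs : 0 < s) :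
    IsCausalVec G X q (s • v) := by
  constructor
  · simp only [map_smul, smul_apply, smul_eq_mul]
    exact mul_nonpos_of_nonneg_of_nonpos hs.le (mul_nonpos_of_nonneg_of_nonpos hs.le h.1)
  · simp only [map_smul, smul_eq_mul]
    exact mul_neg_of_pos_of_neg hs h.2

/-- The amount by which `pushDown` moves the point `q`. -/
noncomputable def pushAmount (τ : E →L[ℝ] ℝ) (q₀ : E) (C ε : ℝ) (q : E) : ℝ :=
  ε * Real.exp (-(C * τ (q - q₀)))

/-- Translation in the direction `-T` by an amount that decreases exponentially with `τ`. -/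
noncomputable def pushDown (τ : E →L[ℝ] ℝ) (q₀ T : E) (C ε : ℝ) (q : E) : E :=
  q - pushAmount τ q₀ C ε q • T

/-- With `η` the `pushAmount`, `η' = -C * τ v * η` along the curve, so the new velocity is `v + (η *
C * τ v) • T`, exactly the vector that `hN` declares causal. -/
theorem Spacetime.IsCoordCausalSegment.pushDown_comp {τ : E →L[ℝ] ℝ} {q₀ T : E} {C ε : ℝ}
    {N : Set E} (hN : ∀ q ∈ N, ∀ η : ℝ, 0 ≤ η → q - η • T ∈ N →
        ∀ v, IsCausalVec G X q v → IsCausalVec G X (q - η • T) (v + (η * C * τ v) • T))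
    {c : ℝ → E} {a b : ℝ} (h : IsCoordCausalSegment G X c a b) (hε : 0 ≤ ε)
    (hc : MapsTo c (Icc a b) N) (hc' : MapsTo (pushDown τ q₀ T C ε ∘ c) (Icc a b) N) :
    IsCoordCausalSegment G X (pushDown τ q₀ T C ε ∘ c) a b := by
  refine ⟨h.1, ?_, fun t ht ↦ ?_⟩
  · have : ContDiff ℝ 1 (pushDown τ q₀ T C ε) := by
      unfold pushDown pushAmount
      fun_prop
    exact this.comp_contDiffOn h.2.1
  · obtain ⟨v, hv, hcv⟩ := h.2.2 t ht
    refine ⟨_, ?_, hN _ (hc ht) (pushAmount τ q₀ C ε (c t)) (by unfold pushAmount; positivity)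
      (hc' ht) v hcv⟩
    have h1 : HasDerivWithinAt (fun t ↦ τ (c t - q₀)) (τ v) (Icc a b) t :=
      τ.hasFDerivAt.comp_hasDerivWithinAt t (hv.sub_const q₀)
    have h2 := ((((h1.const_mul C).neg.exp).const_mul ε).smul_const T)
    refine (hv.sub h2).congr_deriv ?_
    rw [sub_eq_add_neg, ← neg_smul]
    congr 2
    simp only [pushAmount, Pi.neg_apply]
    ring

/-- The upper bound keeps pushed points close; the lower bound guarantees room at the endpoint.
Neither depends on the curve. -/
theorem pushAmount_mem_Icc {τ : E →L[ℝ] ℝ} {q₀ : E} {C ε R : ℝ} {q : E} (hε : 0 ≤ ε)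
    (hq : q ∈ Metric.ball q₀ R) : pushAmount τ q₀ C ε q ∈
      Icc (ε * Real.exp (-(|C| * (‖τ‖ * R)))) (ε * Real.exp (|C| * (‖τ‖ * R))) := by
  have h : |C * τ (q - q₀)| ≤ |C| * (‖τ‖ * R) := by
    rw [abs_mul]
    gcongr
    refine (τ.le_opNorm _).trans ?_
    gcongr
    exact (mem_ball_iff_norm.1 hq).le
  have := abs_le.1 h
  unfold pushAmount
  constructor
  · exact mul_le_mul_of_nonneg_left (Real.exp_le_exp.2 (by linarith)) hε
  · exact mul_le_mul_of_nonneg_left (Real.exp_le_exp.2 (by linarith)) hε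

end Push

/-! ### The push lemma and the two limit arguments. -/

namespace Spacetime

variable {n : ℕ} {r : ℕ∞} {M : Type*} [TopologicalSpace M]
  [ChartedSpace (EuclideanSpace ℝ (Fin n)) M] [IsManifold (𝓡 n) 1 M]

theorem isCoordCausalSegment_line {E : Type*} [NormedAddCommGroup E] [NormedSpace ℝ E]
    {G : E → E →L[ℝ] E →L[ℝ] ℝ} {X : E → E} {p q : E} {N : Set E} (hN : Convex ℝ N)
    (hp : p ∈ N) (hq : q ∈ N) (h : ∀ z ∈ N, IsCausalVec G X z (q - p)) :
    IsCoordCausalSegment G X (AffineMap.lineMap p q) (0 : ℝ) 1 ∧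
      MapsTo (AffineMap.lineMap p q : ℝ → E) (Icc (0 : ℝ) 1) N := by
  have hm : MapsTo (AffineMap.lineMap p q : ℝ → E) (Icc (0 : ℝ) 1) N := fun t ht ↦
    hN.lineMap_mem hp hq ht
  refine ⟨⟨one_pos, ?_, fun t ht ↦ ⟨q - p, ?_, h _ (hm ht)⟩⟩, hm⟩
  · simp only [AffineMap.coe_lineMap, vsub_eq_sub, vadd_eq_add]
    fun_prop
  · exact AffineMap.hasDerivWithinAt_lineMap

/-- Near `x`, the end of a causal curve has a neighbourhood in the causal future of points
arbitrarily close to the start of the curve; the neighbourhood depends on the curve only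
through approximate positions of the endpoints. -/
theorem exists_nhds_subset_future (S : Spacetime n r M) (hr : 2 ≤ r) (x : M) :
    ∃ N ∈ 𝓝 x, ∀ V ∈ 𝓝 x, ∀ z ∈ N, ∃ V' ∈ 𝓝 x, ∃ W ∈ 𝓝 z,
      ∀ (γ : ℝ → M) (a b : ℝ), S.IsCausalCurve γ a b → MapsTo γ (Icc a b) N → γ a ∈ V' →
        γ b ∈ W → ∀ z' ∈ W, ∃ p ∈ V, (p, z') ∈ S.JPlus := by
  set φ := extChartAt (𝓡 n) x with hφ
  set q₀ := φ x with hq₀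
  have hq₀t : q₀ ∈ φ.target := mem_extChartAt_target x
  have htn : φ.target ∈ 𝓝 q₀ := (isOpen_extChartAt_target x).mem_nhds hq₀t
  obtain ⟨τ, T, C, ρ, R, hρ, hR, hRt, hcone, hpush⟩ := exists_uniform_cone
    ((S.contDiffOn_coordMetric hr x).contDiffAt htn) ((S.continuousOn_coordField x).continuousAt htn)
    (Filter.Eventually.of_forall (S.coordMetric_symm x)) (coordMetric_coordField_neg hq₀t)
    (coordMetric_nondegenerate hq₀t) htn
  have hopen : ∀ q s, IsOpen (φ.source ∩ φ ⁻¹' Metric.ball q s) := fun q s ↦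
    (continuousOn_extChartAt x).isOpen_inter_preimage (isOpen_extChartAt_source x) Metric.isOpen_ball
  have hxs : x ∈ φ.source := mem_extChartAt_source x
  refine ⟨φ.source ∩ φ ⁻¹' Metric.ball q₀ (R / 2), (hopen _ _).mem_nhds
    ⟨hxs, Metric.mem_ball_self (half_pos hR)⟩, fun V hV z hz ↦ ?_⟩
  obtain ⟨σ, hσ, hσV⟩ : ∃ σ > 0, Metric.ball q₀ σ ⊆ φ.symm ⁻¹' V := by
    apply Metric.mem_nhds_iff.1
    apply (continuousAt_extChartAt_symm x).preimage_mem_nhds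
    rwa [extChartAt_to_inv]
  set Λ := Real.exp (|C| * (‖τ‖ * (R / 2))) with hΛ
  have hΛ0 : 0 < Λ := Real.exp_pos _
  -- `β` bounds the displacement: `β ≤ R / 2` keeps pushed curves in the ball of radius `R`, and `β
  -- ≤ σ / 2` keeps their starting points in `V`.
  set β := min R σ / 2 with hβ
  have hβ0 : 0 < β := by positivity
  set ε := β / (Λ * (‖T‖ + 1)) with hε
  have hε0 : 0 < ε := by positivity
  set Φ := pushDown τ q₀ T C ε with hΦ
  have hΦd : ∀ q ∈ Metric.ball q₀ (R / 2), ‖Φ q - q‖ ≤ β := by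
    intro q hq
    have h1 := pushAmount_mem_Icc (τ := τ) (C := C) hε0.le hq
    have h0 : 0 ≤ pushAmount τ q₀ C ε q := by unfold pushAmount; positivity
    rw [hΦ, pushDown, sub_sub_cancel_left, norm_neg, norm_smul, Real.norm_of_nonneg h0]
    calc _ ≤ ε * Λ * (‖T‖ + 1) := by
          gcongr
          · exact h1.2
          · linarith
      _ = β := by
          rw [hε]
          field_simp
  have hΦR : ∀ q ∈ Metric.ball q₀ (R / 2), Φ q ∈ Metric.ball q₀ R := by
    intro q hq
    have h1 := hΦd q hq
    rw [mem_ball_iff_norm] at hq ⊢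
    have := norm_add_le (Φ q - q) (q - q₀)
    rw [sub_add_sub_cancel] at this
    have : β ≤ R / 2 := by
      rw [hβ]
      gcongr
      exact min_le_left _ _
    linarith
  -- Half the least push times the cone radius `ρ`: two points within `κ` of `φ z` differ by at most
  -- `η * ρ`.
  set κ := ε * Real.exp (-(|C| * (‖τ‖ * (R / 2)))) * ρ / 2 with hκ
  have hκ0 : 0 < κ := by positivity
  refine ⟨φ.source ∩ φ ⁻¹' Metric.ball q₀ (σ / 2), (hopen _ _).mem_nhds
    ⟨hxs, Metric.mem_ball_self (half_pos hσ)⟩,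
    (φ.source ∩ φ ⁻¹' Metric.ball q₀ (R / 2)) ∩ (φ.source ∩ φ ⁻¹' Metric.ball (φ z) κ),
    Filter.inter_mem ((hopen _ _).mem_nhds hz)
      ((hopen _ _).mem_nhds ⟨hz.1, Metric.mem_ball_self hκ0⟩), ?_⟩
  intro γ a b hγ hγN hγa hγb z' hz'
  have ha := hγN (left_mem_Icc.2 hγ.lt.le)
  have hb := hγN (right_mem_Icc.2 hγ.lt.le)
  have hmap : S.IsCausalCurve ((φ.symm ∘ Φ ∘ φ) ∘ γ) a b := by
    refine hγ.map (N := φ.source ∩ φ ⁻¹' Metric.ball q₀ (R / 2)) (fun a b hs hm ↦ ?_) hγN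
    have h1 := hs.extChartAt_comp (x := x) fun t ht ↦ (hm ht).1
    have h2 : MapsTo (φ ∘ γ) (Icc a b) (Metric.ball q₀ R) := fun t ht ↦
      Metric.ball_subset_ball (by linarith) (hm ht).2
    have h3 : MapsTo (Φ ∘ φ ∘ γ) (Icc a b) (Metric.ball q₀ R) := fun t ht ↦ hΦR _ (hm ht).2
    exact (h1.pushDown_comp hpush hε0.le h2 h3).extChartAt_symm_comp fun t ht ↦ hRt (h3 ht)
  refine ⟨φ.symm (Φ (φ (γ a))), hσV ?_, ?_⟩
  · have h1 := hΦd _ ha.2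
    have h2 := hγa.2
    rw [mem_preimage, mem_ball_iff_norm] at h2
    rw [mem_ball_iff_norm]
    have := norm_add_le (Φ (φ (γ a)) - φ (γ a)) (φ (γ a) - q₀)
    rw [sub_add_sub_cancel] at this
    have : β ≤ σ / 2 := by
      rw [hβ]
      gcongr
      exact min_le_right _ _
    linarith
  · have hJ₁ : (φ.symm (Φ (φ (γ a))), φ.symm (Φ (φ (γ b)))) ∈ S.JPlus :=
      Or.inr ⟨_, a, b, hmap, rfl, rfl⟩
    refine JPlus_trans hJ₁ ?_
    have hz'R : φ z' ∈ Metric.ball q₀ R := Metric.ball_subset_ball (by linarith) hz'.1.2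
    set η := pushAmount τ q₀ C ε (φ (γ b)) with hη
    have hη0 : 0 < η := by
      rw [hη]
      unfold pushAmount
      positivity
    have hdir : ∀ q ∈ Metric.ball q₀ R, IsCausalVec (S.coordMetric x) (S.coordField x) q
        (φ z' - Φ (φ (γ b))) := by
      intro q hq
      -- The pushed endpoint sees `z'` in the direction `T` up to an error of norm at most `ρ`, so
      -- the straight line to `z'` is causal.
      have hw : φ z' - Φ (φ (γ b)) = η • (T + η⁻¹ • (φ z' - φ (γ b))) := by
        rw [smul_add, smul_smul, mul_inv_cancel₀ hη0.ne', one_smul, hΦ, pushDown, ← hη]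
        abel
      rw [hw]
      refine (hcone q hq _ ?_).smul hη0
      rw [add_sub_cancel_left, norm_smul, norm_inv, Real.norm_of_nonneg hη0.le,
        inv_mul_le_iff₀ hη0]
      have h1 := mem_ball_iff_norm.1 hz'.2.2
      have h2 := mem_ball_iff_norm.1 hγb.2.2
      have h3 := norm_sub_le (φ z' - φ z) (φ (γ b) - φ z)
      rw [sub_sub_sub_cancel_right] at h3
      have h4 : 2 * κ ≤ η * ρ := by
        have := (pushAmount_mem_Icc (τ := τ) (C := C) hε0.le hb.2).1
        calc 2 * κ = ε * Real.exp (-(|C| * (‖τ‖ * (R / 2)))) * ρ := by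
              rw [hκ]
              ring
          _ ≤ η * ρ := by gcongr
      linarith
    obtain ⟨hline, hmaps⟩ := isCoordCausalSegment_line (convex_ball q₀ R) (hΦR _ hb.2) hz'R hdir
    refine Or.inr ⟨_, 0, 1, (hline.extChartAt_symm_comp (x := x)
      fun t ht ↦ hRt (hmaps ht)).isCausalCurve, ?_, ?_⟩
    · simp [hφ]
    · simp only [Function.comp_apply, AffineMap.lineMap_apply_one]
      exact φ.left_inv hz'.1.1

/-- If `A⁺` is antisymmetric then the spacetime is strongly causal. -/
theorem ACausal.stronglyCausal [T2Space M] [SecondCountableTopology M] {S : Spacetime n r M}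
    (hS : S.ACausal) : S.StronglyCausal := by
  have : LocallyCompactSpace M := ChartedSpace.locallyCompactSpace (EuclideanSpace ℝ (Fin n)) M
  intro x U hU
  obtain ⟨K, hK, hKU, hKc⟩ := local_compact_nhds hU
  by_contra! hcon
  obtain ⟨B, hB⟩ := (𝓝 x).exists_antitone_basis
  have hstep : ∀ k, ∃ p q w, p ∈ B k ∧ w ∈ B k ∧ q ∈ frontier K ∧ (p, q) ∈ S.JPlus ∧
      (q, w) ∈ S.JPlus := by
    intro k
    -- Intersecting with `K` makes the curve start in `K`; since it leaves `U ⊇ K`, it must cross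
    -- the frontier.
    obtain ⟨γ, a, b, hγ, ha, hb, t, ht, htU⟩ := hcon (K ∩ B k)
      (Filter.inter_mem hK (hB.1.mem_of_mem trivial)) (inter_subset_left.trans hKU)
    obtain ⟨s, hs, hsf, -⟩ := exists_first_mem_frontier ht.1
      (hγ.continuousOn.mono (Icc_subset_Icc_right ht.2)) hKc.isClosed ha.1 fun h ↦ htU (hKU h)
    have hs' : s ∈ Icc a b := ⟨hs.1, hs.2.trans ht.2⟩
    exact ⟨_, _, _, ha.2, hb.2, hsf, hγ.left_mem_JPlus hs', hγ.mem_JPlus_right hs'⟩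
  choose p q w hp hw hq hpq hqw using hstep
  obtain ⟨z, hz, f, hf, hlim⟩ :=
    (hKc.of_isClosed_subset isClosed_frontier hKc.isClosed.frontier_subset).tendsto_subseq hq
  have hpx := (hB.tendsto hp).comp hf.tendsto_atTop
  have hwx := (hB.tendsto hw).comp hf.tendsto_atTop
  have h1 : (x, z) ∈ S.APlus := mem_closure_of_tendsto (hpx.prodMk_nhds hlim)
    (Filter.Eventually.of_forall fun k ↦ hpq (f k))
  have h2 : (z, x) ∈ S.APlus := mem_closure_of_tendsto (hlim.prodMk_nhds hwx)
    (Filter.Eventually.of_forall fun k ↦ hqw (f k))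
  have hxz := hS x z h1 h2
  rw [← hxz] at hz
  exact hz.2 (mem_interior_iff_mem_nhds.2 hK)

/-- A violation of antisymmetry would yield causal diamonds with vertices arbitrarily near `x` that
contain points near some `z ≠ x`. -/
theorem StronglyCausal.aCausal [T2Space M] [SecondCountableTopology M] {S : Spacetime n r M}
    (hr : 2 ≤ r) (hS : S.StronglyCausal) (htrans : TransitiveRel S.APlus) : S.ACausal := by
  have : LocallyCompactSpace M := ChartedSpace.locallyCompactSpace (EuclideanSpace ℝ (Fin n)) M
  intro x y hxy hyx
  by_contra hne
  obtain ⟨N, hN, hpush⟩ := S.exists_nhds_subset_future hr x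
  -- `K` omits `y`, which forces the curves out of it, and lies in `N`, where the push is available.
  obtain ⟨K, hK, hKN, hKc⟩ := local_compact_nhds
    (Filter.inter_mem hN (isOpen_compl_singleton.mem_nhds (show x ∈ ({y}ᶜ : Set M) from hne)))
  have hyK : y ∉ K := fun h ↦ (hKN h).2 rfl
  obtain ⟨u, hu, hulim⟩ := mem_closure_iff_seq_limit.1 hxy
  rw [nhds_prod_eq, Filter.tendsto_prod_iff'] at hulim
  obtain ⟨k₀, hk₀⟩ := Filter.eventually_atTop.1
    ((hulim.1.eventually (interior_mem_nhds.2 hK)).and (hulim.2.eventually (hKc.isClosed.isOpen_compl.mem_nhds hyK)))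
  have hstep : ∀ k, ∃ (γ : ℝ → M) (a s : ℝ), S.IsCausalCurve γ a s ∧ MapsTo γ (Icc a s) N ∧
      γ a = (u (k + k₀)).1 ∧ γ s ∈ frontier K ∧ (γ s, (u (k + k₀)).2) ∈ S.JPlus := by
    intro k
    obtain ⟨h1, h2⟩ : (u (k + k₀)).1 ∈ interior K ∧ (u (k + k₀)).2 ∉ K := hk₀ (k + k₀) (by omega)
    have hJ := hu (k + k₀)
    rcases hJ with (h : (u (k + k₀)).1 = (u (k + k₀)).2) | ⟨γ, a, b, hγ, ha, hb⟩
    · rw [h] at h1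
      exact absurd (interior_subset h1) h2
    rw [← ha] at h1
    rw [← hb] at h2
    obtain ⟨s, hs, hsf, hsK⟩ := exists_first_mem_frontier hγ.lt.le hγ.continuousOn hKc.isClosed
      (interior_subset h1) h2
    have has : a < s := by
      refine hs.1.lt_of_ne ?_
      rintro rfl
      exact hsf.2 h1
    refine ⟨γ, a, s, hγ.restrict_left has hs.2, fun t ht ↦ (hKN (hsK t ht)).1, ha, hsf, ?_⟩
    rw [← hb]
    exact hγ.mem_JPlus_right hs
  choose γ a s hγ hγN hγa hγs hJ using hstep
  obtain ⟨z, hz, f, hf, hlim⟩ :=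
    (hKc.of_isClosed_subset isClosed_frontier hKc.isClosed.frontier_subset).tendsto_subseq hγs
  have hfk : Filter.Tendsto (fun k ↦ f k + k₀) Filter.atTop Filter.atTop :=
    Filter.tendsto_atTop_mono (fun k ↦ Nat.le_add_right _ _) hf.tendsto_atTop
  have hzy : (z, y) ∈ S.APlus := mem_closure_of_tendsto
    (hlim.prodMk_nhds (hulim.2.comp hfk)) (Filter.Eventually.of_forall fun k ↦ hJ (f k))
  -- Transitivity of `A⁺` enters only here: it moves the return relation from `y` to the nearby
  -- point `z`.
  have hzx : (z, x) ∈ S.APlus := htrans z y x hzy hyx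
  have hxz : x ≠ z := by
    rintro rfl
    exact hz.2 (mem_interior_iff_mem_nhds.2 hK)
  obtain ⟨U, U', hU, hU', hxU, hzU', hdisj⟩ := t2_separation hxz
  obtain ⟨V, hV, hVU⟩ := hS.exists_nhds (hU.mem_nhds hxU)
  obtain ⟨V', hV', W, hW, hfut⟩ := hpush V hV z (hKN (hKc.isClosed.frontier_subset hz)).1
  -- `z'` is chosen in `W` before the curve: `W` works for every curve starting in `V'` and ending
  -- in `W`.
  obtain ⟨⟨z', x'⟩, ⟨⟨hz'W, hz'U⟩, hx'V⟩, hzx'⟩ := mem_closure_iff_nhds.1 hzx ((W ∩ U') ×ˢ V)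
    (prod_mem_nhds (Filter.inter_mem hW (hU'.mem_nhds hzU')) hV)
  obtain ⟨k, hk₁, hk₂⟩ := (((hulim.1.comp hfk).eventually hV').and (hlim.eventually hW)).exists
  obtain ⟨p, hp, hpz⟩ := hfut (γ (f k)) (a (f k)) (s (f k)) (hγ _) (hγN _)
    (by rw [hγa]; exact hk₁) hk₂ z' hz'W
  exact disjoint_left.1 hdisj (hVU p z' x' hp hx'V hpz hzx') hz'U

end Spacetime

theorem mainTheorem5 {n : ℕ} (hn : 2 ≤ n) {r : ℕ∞} (hr : 3 ≤ r)
    {M : Type*} [TopologicalSpace M] [T2Space M] [SecondCountableTopology M] [ConnectedSpace M]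
    [ChartedSpace (EuclideanSpace ℝ (Fin n)) M] [IsManifold (𝓡 n) 1 M]
    (S : Spacetime n r M) :
    S.CausallyEasy ↔ S.StronglyCausal ∧ Spacetime.TransitiveRel (closure S.JPlus) := by
  constructor
  · rintro ⟨hA, hK⟩
    refine ⟨hA.stronglyCausal, fun x y z hxy hyz ↦ ?_⟩
    change (x, z) ∈ S.APlus
    change (x, y) ∈ S.APlus at hxy
    change (y, z) ∈ S.APlus at hyz
    -- `K⁺` is an intersection of transitive relations, hence transitive.
    rw [hK] at hxy hyz ⊢
    exact fun R hR ↦ hR.2.1 x y z (hxy R hR) (hyz R hR)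
  · rintro ⟨hS, ht⟩
    refine ⟨hS.aCausal (le_trans (by norm_num) hr) ht, subset_antisymm ?_ ?_⟩
    · exact subset_sInter fun R hR ↦ closure_minimal hR.2.2 hR.1
    · exact sInter_subset_of_mem ⟨isClosed_closure, ht, subset_closure⟩
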